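/- Let $p,q\ge 0$ and $m$ be integers and let $C_p$, $C_q$ be the real Clifford algebras of the positive definite quadratic forms $v_1^2+\cdots+v_p^2$ and $v_{p+1}^2+\cdots+v_{p+q}^2$, with standard generators $e_1,\dots,e_p$ and $e_{p+1},\dots,e_{p+q}$ (so $e_i^2=1$). Let $\rho: C_p\otimes_{\mathbb R} C_q\to M(m;\mathbb R)$ be a (unital) representation of the ordinary tensor product algebra on $W=\mathbb R^m$ such that the matrices $S_i=\rho(e_i)$ $(1\le i\le p+q)$ are symmetric (where $e_i$ stands for $e_i\otimes 1$ if $i\le p$ and for $1\otimes e_i$ if $i>p$). The Clifford quartic form associated with $\rho$ is $$\tilde P(w)=\sum_{i=1}^{p}({}^t w S_i w)^2-\sum_{j=p+1}^{p+q}({}^t w S_j w)^2\qquad (w\in W).$$ If $(p,q,m)$ is equal to one of $$(1,0,m)\ (m\ge 1),\ (2,0,2),\ (1,1,2),\ (3,0,4),\ (2,1,4),\ (5,0,8),\ (4,1,8),\ (3,2,8),\ (9,0,16),\ (8,1,16),\ (5,4,16),$$ then there exist a real quadratic form $f$ on $W$ and a constant $c\in\mathbb R$, $c\neq 0$, such that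 $\tilde P(w)=c\,f(w)^2$ for all $w\in W$. -/

import Mathlib

open scoped TensorProduct

noncomputable section

/-- The positive definite quadratic form `v₁² + ⋯ + vₙ²` on `ℝⁿ`. -/
def sumSq (n : ℕ) : QuadraticForm ℝ (Fin n → ℝ) :=
  QuadraticMap.weightedSumSquares ℝ (fun _ : Fin n => (1 : ℝ))

/-- The real algebra `R_{p,q} = C_p ⊗ C_q`: the ordinary (ungraded) tensor product of the Clifford
algebras of the positive definite forms `sumSq p` and `sumSq q`. -/
abbrev CliffTensor (p q : ℕ) : Type :=
  CliffordAlgebra (sumSq p) ⊗[ℝ] CliffordAlgebra (sumSq q)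

/-- The standard basis vectors `e₁, …, e_{p+q}` inside `C_p ⊗ C_q`: the first `p` of them are
`eᵢ ⊗ 1`, the last `q` of them are `1 ⊗ eⱼ`. -/
def cliffBasis (p q : ℕ) : Fin p ⊕ Fin q → CliffTensor p q
  | Sum.inl i => CliffordAlgebra.ι (sumSq p) (Pi.single i 1) ⊗ₜ[ℝ] 1
  | Sum.inr j => 1 ⊗ₜ[ℝ] CliffordAlgebra.ι (sumSq q) (Pi.single j 1)

/-- The matrices `S_i = ρ(e_i)` of an `m`-dimensional real representation `ρ` of `C_p ⊗ C_q`. -/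
def basisMatrix {p q m : ℕ} (ρ : CliffTensor p q →ₐ[ℝ] Matrix (Fin m) (Fin m) ℝ)
    (i : Fin p ⊕ Fin q) : Matrix (Fin m) (Fin m) ℝ :=
  ρ (cliffBasis p q i)

/-- The form `P(v) = v₁² + ⋯ + v_p² - v_{p+1}² - ⋯ - v_{p+q}²` of signature `(p, q)`. -/
def signatureForm (p q : ℕ) : QuadraticForm ℝ (Fin p ⊕ Fin q → ℝ) :=
  QuadraticMap.weightedSumSquares ℝ (Sum.elim (fun _ => (1 : ℝ)) (fun _ => (-1 : ℝ)))

/-- The quadratic mapping `Q(w) = (S₁[w], …, S_{p+q}[w])`, where `S[w] = ᵗw S w`. -/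
def cliffQuadMap {p q m : ℕ} (ρ : CliffTensor p q →ₐ[ℝ] Matrix (Fin m) (Fin m) ℝ)
    (w : Fin m → ℝ) : Fin p ⊕ Fin q → ℝ :=
  fun i => w ⬝ᵥ (basisMatrix ρ i).mulVec w

/-- The Clifford quartic form `P̃(w) = P(Q(w))` associated with `ρ`. -/
def cliffQuartic {p q m : ℕ} (ρ : CliffTensor p q →ₐ[ℝ] Matrix (Fin m) (Fin m) ℝ)
    (w : Fin m → ℝ) : ℝ :=
  signatureForm p q (cliffQuadMap ρ w)

end

/-! The `S_i` form two commuting families of pairwise anticommuting symmetric involutions.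
Everything rests on splitting `w = u + v` along the eigenspaces of one involution `S 0`, which the
other members of its family interchange.

Hopf case (`sum_sq_inner_eq`): on `ℝ²ⁿ` the `n` vectors `S i.succ u` are an orthogonal basis of the
`-1` eigenspace when `u ≠ 0`, so Parseval turns `(|u|² - |v|²)² + 4 ∑ ⟪S i.succ u, v⟫²` into `|w|⁴`.
This settles `q = 0`, `p = 2, 3, 5, 9`.

For `(4,1,8)` and `(8,1,16)` the volume element `R` of `S` completes a Hopf family, while
irreducibility forces `T = ±1`; the quartic is `-⟪w, R w⟫²`. For `(3,2,8)` and `(5,4,16)` a product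
`R` of generators completes `T` to a family as large as `S`. Two such commuting families on `ℝ⁴ⁿ`
have equal sums of squares (`sum_sq_inner_eq_of_commute`), so the quartic is `⟪w, R w⟫²`. The cases
`(1,1,2)` and `(2,1,4)` are explicit computations in eigenvector coordinates. -/

open scoped RealInnerProductSpace
open Module

/-! ### Orthogonal vectors and eigenspaces of involutions. -/

section Involutions

variable {V : Type*} [NormedAddCommGroup V] [InnerProductSpace ℝ V]

/-- Parseval's identity for `finrank V` orthogonal vectors of equal length. -/
theorem sum_sq_inner_of_orthogonal [FiniteDimensional ℝ V] {ι : Type*} [Fintype ι] [DecidableEq ι]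
    (hV : finrank ℝ V = Fintype.card ι) (e : ι → V) (r : ℝ)
    (he : ∀ i j, ⟪e i, e j⟫ = if i = j then r else 0) (y : V) :
    ∑ i, ⟪e i, y⟫ ^ 2 = r * ⟪y, y⟫ := by
  by_cases hr : r = 0
  · have h0 : ∀ i, e i = 0 := fun i => by
      have := he i i
      rw [if_pos rfl, hr] at this
      exact inner_self_eq_zero.mp this
    simp [h0, hr]
  rcases isEmpty_or_nonempty ι with hι | hι
  · have : Subsingleton V := finrank_zero_iff.mp (by simpa using hV)
    simp [Subsingleton.elim y 0]
  have hli : LinearIndependent ℝ e := by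
    rw [Fintype.linearIndependent_iff]
    intro g hg i
    have := congrArg (fun z => ⟪e i, z⟫) hg
    simp only [inner_sum, inner_smul_right, he, inner_zero_right] at this
    simpa [hr] using this
  let b := basisOfLinearIndependentOfCardEqFinrank hli hV.symm
  have hb : ∀ i, b i = e i := fun i => by simp [b]
  have hy : y = ∑ i, b.repr y i • e i := by
    conv_lhs => rw [← b.sum_repr y]
    simp [hb]
  have hc : ∀ i, ⟪e i, y⟫ = b.repr y i * r := fun i => by
    conv_lhs => rw [hy]
    simp [inner_sum, inner_smul_right, he]
  have hyy : ⟪y, y⟫ = ∑ i, b.repr y i * ⟪e i, y⟫ := by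
    conv_lhs => rw [hy, sum_inner, ← hy]
    simp [inner_smul_left]
  rw [hyy, Finset.mul_sum]
  exact Finset.sum_congr rfl fun i _ => by rw [hc i]; ring

/-- Parseval's identity inside a subspace. -/
theorem sum_sq_inner_of_orthogonal_of_mem [FiniteDimensional ℝ V] {ι : Type*} [Fintype ι]
    [DecidableEq ι] (F : Submodule ℝ V)
    (hF : finrank ℝ F = Fintype.card ι) (e : ι → V) (heF : ∀ i, e i ∈ F) (r : ℝ)
    (he : ∀ i j, ⟪e i, e j⟫ = if i = j then r else 0) {y : V} (hy : y ∈ F) :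
    ∑ i, ⟪e i, y⟫ ^ 2 = r * ⟪y, y⟫ :=
  sum_sq_inner_of_orthogonal (V := F) hF (fun i => ⟨e i, heF i⟩) r he ⟨y, hy⟩

theorem card_le_finrank_of_orthogonal [FiniteDimensional ℝ V] {ι : Type*} [Fintype ι]
    [DecidableEq ι] (F : Submodule ℝ V) (e : ι → V) (heF : ∀ i, e i ∈ F) {r : ℝ} (hr : r ≠ 0)
    (he : ∀ i j, ⟪e i, e j⟫ = if i = j then r else 0) :
    Fintype.card ι ≤ finrank ℝ F := by
  have hli : LinearIndependent ℝ (fun i => (⟨e i, heF i⟩ : F)) := by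
    rw [Fintype.linearIndependent_iff]
    intro g hg i
    have := congrArg (fun z => ⟪(⟨e i, heF i⟩ : F), z⟫) hg
    simp only [inner_sum, inner_smul_right, inner_zero_right, Submodule.coe_inner, he] at this
    simpa [hr] using this
  exact hli.fintype_card_le_finrank

/-- The projection onto the eigenspace is `(1 + ε R) / 2`, and the trace of a projection is its
rank. -/
theorem two_mul_finrank_eigenspace [FiniteDimensional ℝ V] (R : V →ₗ[ℝ] V)
    (hR : ∀ x, R (R x) = x) {ε : ℝ} (hε : ε * ε = 1) :
    2 * (finrank ℝ (End.eigenspace R ε) : ℝ) = finrank ℝ V + ε * LinearMap.trace ℝ V R := by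
  have hP : LinearMap.IsProj (End.eigenspace R ε)
      ((1 / 2 : ℝ) • (LinearMap.id + ε • R) : V →ₗ[ℝ] V) := by
    constructor
    · intro x
      rw [End.mem_eigenspace_iff]
      simp only [LinearMap.smul_apply, LinearMap.add_apply, LinearMap.id_apply, map_smul, map_add,
        hR, smul_add, smul_smul]
      rw [add_comm]
      congr 2
      · ring
      · rw [mul_left_comm, hε, mul_one]
    · intro x hx
      rw [End.mem_eigenspace_iff] at hx
      simp only [LinearMap.smul_apply, LinearMap.add_apply, LinearMap.id_apply, hx, smul_smul, hε,
        one_smul, ← two_smul ℝ x]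
      norm_num
  have h := hP.trace
  rw [map_smul, map_add, map_smul, LinearMap.trace_id] at h
  simp only [smul_eq_mul] at h
  linarith

/-- Conjugation by `U` sends `R` to `-R` and preserves the trace. -/
theorem trace_eq_zero_of_anticommute [FiniteDimensional ℝ V] (R U : V →ₗ[ℝ] V)
    (hU : ∀ x, U (U x) = x) (hRU : ∀ x, R (U x) = -U (R x)) : LinearMap.trace ℝ V R = 0 := by
  have h1 : (R * U) * U = R := by ext x; simp [hU]
  have h2 : U * (R * U) = -R := by ext x; simp [hU, hRU]
  have h3 := LinearMap.trace_mul_comm ℝ (R * U) U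
  rw [h1, h2, map_neg] at h3
  linarith

theorem exists_add_of_involution (R : V →ₗ[ℝ] V) (hR : ∀ x, R (R x) = x) (w : V) :
    ∃ u v, R u = u ∧ R v = -v ∧ w = u + v := by
  refine ⟨(1 / 2 : ℝ) • (w + R w), (1 / 2 : ℝ) • (w - R w), ?_, ?_, ?_⟩
  · rw [map_smul, map_add, hR, add_comm]
  · rw [map_smul, map_sub, hR, ← smul_neg, neg_sub]
  · module

theorem LinearMap.IsSymmetric.inner_eq_zero_of_apply_eq_neg {R : V →ₗ[ℝ] V} (hR : R.IsSymmetric)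
    {u v : V} (hu : R u = u) (hv : R v = -v) : ⟪u, v⟫ = 0 := by
  have := hR u v
  rw [hu, hv, inner_neg_right] at this
  linarith

theorem mem_eigenspace_one {R : V →ₗ[ℝ] V} {x : V} : x ∈ End.eigenspace R 1 ↔ R x = x := by
  rw [End.mem_eigenspace_iff, one_smul]

theorem mem_eigenspace_neg_one {R : V →ₗ[ℝ] V} {x : V} :
    x ∈ End.eigenspace R (-1) ↔ R x = -x := by
  rw [End.mem_eigenspace_iff, neg_one_smul]

end Involutions

/-! ### Clifford families and the Hopf identity. -/

/-- A family of pairwise anticommuting symmetric involutions of a Euclidean space. -/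
structure IsCliffordFamily {V : Type*} [NormedAddCommGroup V] [InnerProductSpace ℝ V] {ι : Type*}
    (S : ι → V →ₗ[ℝ] V) : Prop where
  symm : ∀ i, (S i).IsSymmetric
  sq : ∀ i x, S i (S i x) = x
  anti : ∀ i j, i ≠ j → ∀ x, S i (S j x) = -S j (S i x)

namespace IsCliffordFamily

variable {V : Type*} [NormedAddCommGroup V] [InnerProductSpace ℝ V]

theorem restrict {ι : Type*} {S : ι → V →ₗ[ℝ] V} (hS : IsCliffordFamily S) {F : Submodule ℝ V}
    (hF : ∀ i, ∀ x ∈ F, S i x ∈ F) : IsCliffordFamily fun i => (S i).restrict (hF i) where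
  symm i x y := hS.symm i x y
  sq i x := Subtype.ext (hS.sq i x)
  anti i j hij x := Subtype.ext (hS.anti i j hij x)

/-- For `i ≠ j` the product `S i S j` is skew, so `⟪u, S i (S j u)⟫` vanishes. -/
theorem inner_apply_apply {ι : Type*} [DecidableEq ι] {S : ι → V →ₗ[ℝ] V}
    (hS : IsCliffordFamily S) (u : V) (i j : ι) :
    ⟪S i u, S j u⟫ = if i = j then ⟪u, u⟫ else 0 := by
  split_ifs with h
  · rw [h, hS.symm j, hS.sq]
  · have h1 : ⟪S i u, S j u⟫ = ⟪u, S i (S j u)⟫ := hS.symm i _ _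
    have h2 : ⟪S i u, S j u⟫ = ⟪u, S j (S i u)⟫ := by rw [real_inner_comm]; exact hS.symm j _ _
    rw [hS.anti i j h, inner_neg_right] at h1
    linarith

variable {n : ℕ} {S : Fin (n + 1) → V →ₗ[ℝ] V}

theorem apply_succ_eq_neg (hS : IsCliffordFamily S) (i : Fin n) {u : V} (hu : S 0 u = u) :
    S 0 (S i.succ u) = -S i.succ u := by
  rw [hS.anti 0 i.succ (Fin.succ_ne_zero i).symm, hu]

theorem apply_succ_eq_self (hS : IsCliffordFamily S) (i : Fin n) {u : V} (hu : S 0 u = -u) :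
    S 0 (S i.succ u) = S i.succ u := by
  rw [hS.anti 0 i.succ (Fin.succ_ne_zero i).symm, hu, map_neg, neg_neg]

theorem trace_eq_zero [FiniteDimensional ℝ V] (hS : IsCliffordFamily S) (hn : n ≠ 0)
    (i : Fin (n + 1)) : LinearMap.trace ℝ V (S i) = 0 := by
  obtain ⟨j, hj⟩ : ∃ j, i ≠ j := by
    have : Nontrivial (Fin (n + 1)) := Fin.nontrivial_iff_two_le.mpr (by omega)
    obtain ⟨j, hj⟩ := exists_ne i
    exact ⟨j, hj.symm⟩
  exact trace_eq_zero_of_anticommute (S i) (S j) (hS.sq j) (hS.anti i j hj)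

theorem two_mul_finrank_eigenspace_zero [FiniteDimensional ℝ V] (hS : IsCliffordFamily S)
    (hn : n ≠ 0) {ε : ℝ} (hε : ε * ε = 1) :
    2 * finrank ℝ (End.eigenspace (S 0) ε) = finrank ℝ V := by
  have h := two_mul_finrank_eigenspace (S 0) (hS.sq 0) hε
  rw [hS.trace_eq_zero hn, mul_zero, add_zero] at h
  exact_mod_cast h

theorem inner_apply_zero (hS : IsCliffordFamily S) {u v : V} (hu : S 0 u = u) (hv : S 0 v = -v) :
    ⟪u + v, S 0 (u + v)⟫ = ⟪u, u⟫ - ⟪v, v⟫ := by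
  have h := (hS.symm 0).inner_eq_zero_of_apply_eq_neg hu hv
  have h' := real_inner_comm u v
  simp only [map_add, hu, hv, inner_add_left, inner_add_right, inner_neg_right]
  linarith

/-- `S i.succ` swaps the two orthogonal eigenspaces of `S 0`, so only the cross terms survive, and
they agree by symmetry. -/
theorem inner_apply_succ (hS : IsCliffordFamily S) (i : Fin n) {u v : V} (hu : S 0 u = u)
    (hv : S 0 v = -v) : ⟪u + v, S i.succ (u + v)⟫ = 2 * ⟪S i.succ u, v⟫ := by
  have h1 := (hS.symm 0).inner_eq_zero_of_apply_eq_neg hu (hS.apply_succ_eq_neg i hu)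
  have h2 := (hS.symm 0).inner_eq_zero_of_apply_eq_neg (hS.apply_succ_eq_self i hv) hv
  have h3 := real_inner_comm v (S i.succ v)
  have h4 := hS.symm i.succ u v
  have h5 := real_inner_comm (S i.succ u) v
  simp only [map_add, inner_add_left, inner_add_right]
  linarith

theorem inner_add_self (hS : IsCliffordFamily S) {u v : V} (hu : S 0 u = u) (hv : S 0 v = -v) :
    ⟪u + v, u + v⟫ = ⟪u, u⟫ + ⟪v, v⟫ := by
  have h := (hS.symm 0).inner_eq_zero_of_apply_eq_neg hu hv
  rw [real_inner_add_add_self, h]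
  ring

theorem sum_sq_inner (hS : IsCliffordFamily S) {u v : V} (hu : S 0 u = u)
    (hv : S 0 v = -v) :
    ∑ i, ⟪u + v, S i (u + v)⟫ ^ 2 =
      (⟪u, u⟫ - ⟪v, v⟫) ^ 2 + 4 * ∑ i : Fin n, ⟪S i.succ u, v⟫ ^ 2 := by
  rw [Fin.sum_univ_succ, hS.inner_apply_zero hu hv, Finset.mul_sum]
  congr 1
  refine Finset.sum_congr rfl fun i _ => ?_
  rw [hS.inner_apply_succ i hu hv]
  ring

/-- `n + 1` anticommuting symmetric involutions of `ℝ²ⁿ` define a Hopf map. -/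
theorem sum_sq_inner_eq [FiniteDimensional ℝ V] (hS : IsCliffordFamily S) (hn : n ≠ 0)
    (hV : finrank ℝ V = 2 * n) (w : V) : ∑ i, ⟪w, S i w⟫ ^ 2 = ⟪w, w⟫ ^ 2 := by
  obtain ⟨u, v, hu, hv, rfl⟩ := exists_add_of_involution (S 0) (hS.sq 0) w
  have hF := hS.two_mul_finrank_eigenspace_zero hn (ε := -1) (by norm_num)
  have h := sum_sq_inner_of_orthogonal_of_mem (End.eigenspace (S 0) (-1)) (ι := Fin n)
    (by rw [Fintype.card_fin]; omega) (fun i => S i.succ u)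
    (fun i => mem_eigenspace_neg_one.mpr (hS.apply_succ_eq_neg i hu)) ⟪u, u⟫
    (fun i j => by simp [hS.inner_apply_apply]) (mem_eigenspace_neg_one.mpr hv)
  rw [hS.sum_sq_inner hu hv, hS.inner_add_self hu hv, h]
  ring

/-- Polarization of the Hopf map identity. -/
theorem sum_inner_mul_inner [FiniteDimensional ℝ V] (hS : IsCliffordFamily S) (hn : n ≠ 0)
    (hV : finrank ℝ V = 2 * n) (q : Fin n → V →ₗ[ℝ] V)
    (hq : ∀ i j x, S j (q i x) = q i (S j x)) (x y : V)
    (hqx : ∀ i j, ⟪q i x, q j x⟫ = if i = j then ⟪x, x⟫ else 0) :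
    ∑ j, ⟪x, S j x⟫ * ⟪y, S j y⟫ = 2 * ∑ i, ⟪q i x, y⟫ ^ 2 - ⟪x, x⟫ * ⟪y, y⟫ := by
  by_cases hx : x = 0
  · simp [hx]
  have hr : ⟪x, x⟫ ≠ 0 := fun h => hx (inner_self_eq_zero.mp h)
  set r := ⟪x, x⟫ with hrdef
  set a : Fin (n + 1) → ℝ := fun j => ⟪x, S j x⟫ with ha
  have hsum : ∑ j, a j ^ 2 = r ^ 2 := hS.sum_sq_inner_eq hn hV x
  -- `A` satisfies `A² = r²` and `A x = r x`, so `R = r⁻¹ A` is an involution fixing `x`. The `q i`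
  -- commute with `R`, so the `n` vectors `q i x` span its `+1` eigenspace, and Parseval computes
  -- the component of `y` there.
  let A : V →ₗ[ℝ] V := ∑ j, a j • S j
  have hA : ∀ z, A z = ∑ j, a j • S j z := fun z => by simp [A]
  have hAsymm : A.IsSymmetric := fun z z' => by
    simp only [hA, sum_inner, inner_sum, inner_smul_left, inner_smul_right, hS.symm _ z z']
    simp
  have hAA : ∀ z, A (A z) = r ^ 2 • z := fun z => by
    have h1 : A (A z) = ∑ i, ∑ j, (a i * a j) • S i (S j z) := by
      simp only [hA, map_sum, map_smul, Finset.smul_sum, smul_smul]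
    have h2 : A (A z) = ∑ i, ∑ j, (a i * a j) • S j (S i z) := by
      rw [h1, Finset.sum_comm]
      simp only [mul_comm]
    have h3 : ∀ i j, (a i * a j) • S i (S j z) + (a i * a j) • S j (S i z) =
        if i = j then (2 * a i ^ 2) • z else 0 := fun i j => by
      split_ifs with hij
      · subst hij
        rw [hS.sq]
        module
      · rw [hS.anti i j hij, smul_neg, neg_add_cancel]
    -- Symmetrizing the double sum in `i, j` cancels the off-diagonal terms by anticommutation.
    have h4 : (2 : ℝ) • A (A z) = (2 * r ^ 2) • z := by
      rw [two_smul]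
      conv_lhs => rw [h1]
      conv_lhs => rhs; rw [← h1, h2]
      simp only [← Finset.sum_add_distrib, h3, Finset.sum_ite_eq, Finset.mem_univ, if_true]
      rw [← Finset.sum_smul, ← Finset.mul_sum, hsum]
    rw [mul_smul] at h4
    exact smul_right_injective V (two_ne_zero (α := ℝ)) h4
  have hxA : ⟪x, A x⟫ = r ^ 2 := by
    rw [hA, inner_sum, ← hsum]
    exact Finset.sum_congr rfl fun j _ => by rw [inner_smul_right, pow_two]
  -- `|A x - r x|² = r³ - 2r³ + r³ = 0`: the equality case of Cauchy-Schwarz.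
  have hAx : A x = r • x := by
    rw [← sub_eq_zero, ← inner_self_eq_zero (𝕜 := ℝ), inner_sub_left, inner_sub_right,
      inner_sub_right, hAsymm x (A x), hAA]
    simp only [inner_smul_left, inner_smul_right, real_inner_comm x (A x), ← hrdef, hxA,
      conj_trivial]
    ring
  let R : V →ₗ[ℝ] V := r⁻¹ • A
  have hRR : ∀ z, R (R z) = z := fun z => by
    simp only [R, LinearMap.smul_apply, map_smul, hAA, smul_smul]
    rw [show r⁻¹ * (r⁻¹ * r ^ 2) = 1 by field_simp, one_smul]
  have hRsymm : R.IsSymmetric := fun z z' => by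
    simp [R, inner_smul_left, inner_smul_right, hAsymm z z']
  have htr : LinearMap.trace ℝ V R = 0 := by
    simp [R, A, hS.trace_eq_zero hn]
  have hrank := two_mul_finrank_eigenspace R hRR (ε := 1) (by norm_num)
  rw [htr, mul_zero, add_zero, hV] at hrank
  have hrank' : finrank ℝ (End.eigenspace R 1) = n := by
    have : 2 * finrank ℝ (End.eigenspace R 1) = 2 * n := by exact_mod_cast hrank
    omega
  have hqR : ∀ i, R (q i x) = q i x := fun i => by
    have hqA : A (q i x) = q i (A x) := by simp only [hA, hq, map_sum, map_smul]
    rw [LinearMap.smul_apply, hqA, hAx, map_smul, inv_smul_smul₀ hr]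
  have hlhs : ∑ j, a j * ⟪y, S j y⟫ = r * ⟪y, R y⟫ := by
    simp only [R, LinearMap.smul_apply, inner_smul_right, hA, inner_sum]
    rw [← mul_assoc, mul_inv_cancel₀ hr, one_mul]
  obtain ⟨u, v, hu, hv, rfl⟩ := exists_add_of_involution R hRR y
  have hpars := sum_sq_inner_of_orthogonal_of_mem (End.eigenspace R 1) (ι := Fin n)
    (by rw [Fintype.card_fin, hrank']) (fun i => q i x)
    (fun i => mem_eigenspace_one.mpr (hqR i)) r hqx (mem_eigenspace_one.mpr hu)
  have huv := hRsymm.inner_eq_zero_of_apply_eq_neg hu hv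
  have hvu := huv
  rw [real_inner_comm] at hvu
  have hqv : ∀ i, ⟪q i x, u + v⟫ = ⟪q i x, u⟫ := fun i => by
    rw [inner_add_right, hRsymm.inner_eq_zero_of_apply_eq_neg (hqR i) hv, add_zero]
  simp only [hqv]
  rw [hlhs, hpars]
  simp only [map_add, hu, hv, inner_add_left, inner_add_right, inner_neg_right, huv, hvu]
  ring

end IsCliffordFamily

/-! ### Two commuting families, and irreducibility. -/

namespace IsCliffordFamily

variable {V : Type*} [NormedAddCommGroup V] [InnerProductSpace ℝ V] [FiniteDimensional ℝ V]
  {n : ℕ}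

/-- Two commuting families of `n + 1` anticommuting symmetric involutions of `ℝ⁴ⁿ` define quadratic
maps of the same length. -/
theorem sum_sq_inner_eq_of_commute {S T : Fin (n + 1) → V →ₗ[ℝ] V} (hS : IsCliffordFamily S)
    (hT : IsCliffordFamily T) (hn : n ≠ 0) (hST : ∀ i j x, S i (T j x) = T j (S i x))
    (hV : finrank ℝ V = 4 * n) (w : V) : ∑ i, ⟪w, S i w⟫ ^ 2 = ∑ j, ⟪w, T j w⟫ ^ 2 := by
  obtain ⟨k, rfl⟩ := Nat.exists_eq_succ_of_ne_zero hn
  obtain ⟨u, v, hu, hv, rfl⟩ := exists_add_of_involution (S 0) (hS.sq 0) w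
  set F := End.eigenspace (S 0) 1 with hF
  have hrank : finrank ℝ F = 2 * (k + 1) := by
    have := hS.two_mul_finrank_eigenspace_zero hn (ε := 1) (by norm_num)
    rw [← hF, hV] at this
    omega
  -- An isometry that commutes with `T` and carries the `-1` eigenspace of `S 0` to `F`; thus `u`
  -- and `s v` lie in the same space `F`, where `T` is a Hopf family.
  set s : V →ₗ[ℝ] V := S (Fin.succ 0) with hs
  have hTF : ∀ j, ∀ x ∈ F, T j x ∈ F := fun j x hx => by
    rw [hF, mem_eigenspace_one] at hx ⊢
    rw [hST, hx]
  have hqF : ∀ i : Fin (k + 1), ∀ x ∈ F, (s ∘ₗ S i.succ) x ∈ F := fun i x hx => by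
    rw [hF, mem_eigenspace_one] at hx ⊢
    exact hS.apply_succ_eq_self 0 (hS.apply_succ_eq_neg i hx)
  have hsv : S 0 (s v) = s v := hS.apply_succ_eq_self 0 hv
  have hss : ∀ x y, ⟪s x, s y⟫ = ⟪x, y⟫ := fun x y => by rw [hS.symm, hS.sq]
  have hTr := hT.restrict hTF
  have hu' : u ∈ F := mem_eigenspace_one.mpr hu
  have hv' : s v ∈ F := mem_eigenspace_one.mpr hsv
  have hxx : ∑ j, ⟪u, T j u⟫ ^ 2 = ⟪u, u⟫ ^ 2 := hTr.sum_sq_inner_eq hn hrank ⟨u, hu'⟩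
  have hyy : ∑ j, ⟪s v, T j (s v)⟫ ^ 2 = ⟪s v, s v⟫ ^ 2 :=
    hTr.sum_sq_inner_eq hn hrank ⟨s v, hv'⟩
  -- Polarization with `q i = s S i.succ`: these preserve `F`, commute with `T`, and turn `⟪q i u, s
  -- v⟫` into `⟪S i.succ u, v⟫`.
  have hxy : ∑ j, ⟪u, T j u⟫ * ⟪s v, T j (s v)⟫ =
      2 * ∑ i : Fin (k + 1), ⟪s (S i.succ u), s v⟫ ^ 2 - ⟪u, u⟫ * ⟪s v, s v⟫ :=
    hTr.sum_inner_mul_inner hn hrank (fun i => (s ∘ₗ S i.succ).restrict (hqF i))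
      (fun i j x => Subtype.ext (by
        change T j (s (S i.succ x)) = s (S i.succ (T j x))
        rw [hST, hST])) ⟨u, hu'⟩ ⟨s v, hv'⟩
      (fun i j => by
        change ⟪s (S i.succ u), s (S j.succ u)⟫ = if i = j then ⟪u, u⟫ else 0
        rw [hss, hS.inner_apply_apply]
        simp)
  have hTs : ∀ j, ⟪s v, T j (s v)⟫ = ⟪v, T j v⟫ := fun j => by rw [← hST, hss]
  simp only [hss, hTs] at hyy hxy
  have hTw : ∀ j, ⟪u + v, T j (u + v)⟫ = ⟪u, T j u⟫ + ⟪v, T j v⟫ := fun j => by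
    have h1 : S 0 (T j u) = T j u := by rw [hST, hu]
    have h2 : S 0 (T j v) = -T j v := by rw [hST, hv, map_neg]
    have h3 := (hS.symm 0).inner_eq_zero_of_apply_eq_neg hu h2
    have h4 := (hS.symm 0).inner_eq_zero_of_apply_eq_neg h1 hv
    rw [real_inner_comm] at h4
    simp only [map_add, inner_add_left, inner_add_right, h3, h4]
    ring
  rw [hS.sum_sq_inner hu hv]
  simp only [hTw, add_sq, Finset.sum_add_distrib, hxx, hyy, mul_assoc]
  rw [← Finset.mul_sum, hxy]
  ring

/-- A nonzero Euclidean space with `n + 1` anticommuting symmetric involutions has dimension at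
least `2n`. -/
theorem two_mul_le_finrank {S : Fin (n + 1) → V →ₗ[ℝ] V} (hS : IsCliffordFamily S) (hn : n ≠ 0)
    (hV : finrank ℝ V ≠ 0) : 2 * n ≤ finrank ℝ V := by
  have h1 := hS.two_mul_finrank_eigenspace_zero hn (ε := 1) (by norm_num)
  have h2 := hS.two_mul_finrank_eigenspace_zero hn (ε := -1) (by norm_num)
  have hne : End.eigenspace (S 0) 1 ≠ ⊥ := fun h => by
    rw [h, finrank_bot] at h1
    omega
  obtain ⟨u, hu, hu0⟩ := Submodule.exists_mem_ne_zero_of_ne_bot hne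
  rw [mem_eigenspace_one] at hu
  have := card_le_finrank_of_orthogonal (End.eigenspace (S 0) (-1)) (ι := Fin n)
    (fun i => S i.succ u) (fun i => mem_eigenspace_neg_one.mpr (hS.apply_succ_eq_neg i hu))
    (r := ⟪u, u⟫) (fun h => hu0 (inner_self_eq_zero.mp h))
    (fun i j => by simp [hS.inner_apply_apply])
  rw [Fintype.card_fin] at this
  omega

/-- An involution commuting with an irreducible family of `n + 1` anticommuting symmetric
involutions is `±1`. -/
theorem eq_or_eq_neg_of_commute {S : Fin (n + 1) → V →ₗ[ℝ] V} (hS : IsCliffordFamily S)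
    (hn : n ≠ 0) (hV : finrank ℝ V < 4 * n) {T : V →ₗ[ℝ] V} (hT : ∀ x, T (T x) = x)
    (hST : ∀ i x, S i (T x) = T (S i x)) : (∀ x, T x = x) ∨ ∀ x, T x = -x := by
  -- Eigenspaces of `T` are stable under `S`, so two nonzero ones would need total dimension `4 *
  -- n`.
  have hdim : ∀ ε : ℝ, End.eigenspace T ε ≠ ⊥ → 2 * n ≤ finrank ℝ (End.eigenspace T ε) :=
    fun ε hε => (hS.restrict (F := End.eigenspace T ε) fun i x hx => by
      rw [End.mem_eigenspace_iff] at hx ⊢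
      rw [← hST, hx, map_smul]).two_mul_le_finrank hn
        fun h => hε (Submodule.finrank_eq_zero.mp h)
  have h1 := two_mul_finrank_eigenspace T hT (ε := 1) (by norm_num)
  have h2 := two_mul_finrank_eigenspace T hT (ε := -1) (by norm_num)
  have h3 : finrank ℝ (End.eigenspace T 1) + finrank ℝ (End.eigenspace T (-1)) = finrank ℝ V := by
    have : ((finrank ℝ (End.eigenspace T 1) + finrank ℝ (End.eigenspace T (-1)) : ℕ) : ℝ) =
      finrank ℝ V := by push_cast; linarith
    exact_mod_cast this
  by_cases hp : End.eigenspace T 1 = ⊥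
  · right
    intro x
    have : x + T x ∈ End.eigenspace T 1 := by rw [mem_eigenspace_one, map_add, hT, add_comm]
    rw [hp, Submodule.mem_bot] at this
    exact (neg_eq_of_add_eq_zero_right this).symm
  · left
    have hm : End.eigenspace T (-1) = ⊥ := by
      by_contra hm
      have := hdim _ hp
      have := hdim _ hm
      omega
    intro x
    have : x - T x ∈ End.eigenspace T (-1) := by
      rw [mem_eigenspace_neg_one, map_sub, hT, neg_sub]
    rw [hm, Submodule.mem_bot] at this
    exact (sub_eq_zero.mp this).symm

end IsCliffordFamily

/-! ### Extending a family by a product of generators. -/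

namespace IsCliffordFamily

variable {V : Type*} [NormedAddCommGroup V] [InnerProductSpace ℝ V] {n : ℕ}

theorem snoc {S : Fin n → V →ₗ[ℝ] V} (hS : IsCliffordFamily S) {R : V →ₗ[ℝ] V}
    (hR : R.IsSymmetric) (hRR : ∀ x, R (R x) = x) (hSR : ∀ i x, S i (R x) = -R (S i x)) :
    IsCliffordFamily (Fin.snoc (α := fun _ => V →ₗ[ℝ] V) S R) where
  symm i := by
    refine Fin.lastCases ?_ (fun i => ?_) i
    · simpa using hR
    · simpa using hS.symm i
  sq i := by
    refine Fin.lastCases ?_ (fun i => ?_) i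
    · simpa using hRR
    · simpa using hS.sq i
  anti i j := by
    refine Fin.lastCases ?_ (fun i => ?_) i <;> refine Fin.lastCases ?_ (fun j => ?_) j
    · intro h
      exact absurd rfl h
    · intro _ x
      simp [hSR]
    · intro _ x
      simp [hSR]
    · intro h x
      simpa using hS.anti i j (fun h' => h (by rw [h'])) x

/-- The volume element of four anticommuting symmetric involutions extends the family. -/
theorem snoc_four {S : Fin 4 → V →ₗ[ℝ] V} (hS : IsCliffordFamily S) :
    IsCliffordFamily
      (Fin.snoc (α := fun _ => V →ₗ[ℝ] V) S (S 0 ∘ₗ S 1 ∘ₗ S 2 ∘ₗ S 3)) := by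
  -- Oriented so that `simp` sorts products by index. Reversing four generators takes 6
  -- transpositions, an even number, and a generator passes 3 others, an odd number.
  have hlt : ∀ i j x, j < i → S i (S j x) = -S j (S i x) := fun i j x h => hS.anti i j h.ne' x
  refine hS.snoc (fun x y => ?_) (fun x => ?_) (fun i x => ?_)
  · simp only [LinearMap.comp_apply]
    rw [hS.symm, hS.symm, hS.symm, hS.symm]
    simp [hlt]
  · simp [hlt, hS.sq]
  · fin_cases i <;> simp [hlt, hS.sq]

/-- The volume element of eight anticommuting symmetric involutions extends the family. -/
theorem snoc_eight {S : Fin 8 → V →ₗ[ℝ] V} (hS : IsCliffordFamily S) :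
    IsCliffordFamily (Fin.snoc (α := fun _ => V →ₗ[ℝ] V) S
      (S 0 ∘ₗ S 1 ∘ₗ S 2 ∘ₗ S 3 ∘ₗ S 4 ∘ₗ S 5 ∘ₗ S 6 ∘ₗ S 7)) := by
  have hlt : ∀ i j x, j < i → S i (S j x) = -S j (S i x) := fun i j x h => hS.anti i j h.ne' x
  refine hS.snoc (fun x y => ?_) (fun x => ?_) (fun i x => ?_)
  · simp only [LinearMap.comp_apply]
    rw [hS.symm, hS.symm, hS.symm, hS.symm, hS.symm, hS.symm, hS.symm, hS.symm]
    simp [hlt]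
  · simp [hlt, hS.sq]
  · fin_cases i <;> simp [hlt, hS.sq]

/-- Two anticommuting symmetric involutions commuting with three further ones extend to a family of
three. -/
theorem snoc_two {S : Fin 3 → V →ₗ[ℝ] V} {T : Fin 2 → V →ₗ[ℝ] V} (hS : IsCliffordFamily S)
    (hT : IsCliffordFamily T) (hST : ∀ i j x, S i (T j x) = T j (S i x)) :
    IsCliffordFamily (Fin.snoc (α := fun _ => V →ₗ[ℝ] V) T
      (S 0 ∘ₗ S 1 ∘ₗ S 2 ∘ₗ T 0 ∘ₗ T 1)) := by
  -- `S 0 S 1 S 2` and `T 0 T 1` are each skew with square `-1`; they commute, so their product is a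
  -- symmetric involution.
  have hS' : ∀ i j x, j < i → S i (S j x) = -S j (S i x) := fun i j x h => hS.anti i j h.ne' x
  have hT' : ∀ i j x, j < i → T i (T j x) = -T j (T i x) := fun i j x h => hT.anti i j h.ne' x
  refine hT.snoc (fun x y => ?_) (fun x => ?_) (fun i x => ?_)
  · simp only [LinearMap.comp_apply]
    rw [hS.symm, hS.symm, hS.symm, hT.symm, hT.symm]
    simp [hS', hT', ← hST]
  · simp [hS', hT', ← hST, hS.sq, hT.sq]
  · fin_cases i <;> simp [hT', ← hST, hT.sq]

end IsCliffordFamily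

theorem mul_self_eq_one_of_apply_eq_smul {V : Type*} [AddCommGroup V] [Module ℝ V]
    {R : V →ₗ[ℝ] V} (hR : ∀ x, R (R x) = x) {r : ℝ} {x : V} (hx : x ≠ 0) (h : R x = r • x) :
    r * r = 1 := by
  have h1 := hR x
  rw [h, map_smul, h, smul_smul] at h1
  exact smul_left_injective ℝ hx (h1.trans (one_smul ℝ x).symm)

/-- The quadratic form `w ↦ ⟪w, B w⟫`. -/
noncomputable def innerQuadraticForm {V : Type*} [NormedAddCommGroup V] [InnerProductSpace ℝ V]
    (B : V →ₗ[ℝ] V) : QuadraticForm ℝ V :=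
  LinearMap.BilinMap.toQuadraticMap ((innerₗ V).compl₂ B)

theorem innerQuadraticForm_apply {V : Type*} [NormedAddCommGroup V] [InnerProductSpace ℝ V]
    (B : V →ₗ[ℝ] V) (w : V) : innerQuadraticForm B w = ⟪w, B w⟫ := by
  simp [innerQuadraticForm]

/-! ### Mixed signatures. -/

namespace IsCliffordFamily

variable {V : Type*} [NormedAddCommGroup V] [InnerProductSpace ℝ V] [FiniteDimensional ℝ V]
  {n : ℕ}

/-- If the volume element completes `S` to a family acting irreducibly, then the quartic form of
`S` and a commuting involution is minus the square of the volume element's quadratic form. -/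
theorem sum_sq_sub_sq_of_snoc {S : Fin n → V →ₗ[ℝ] V} {R T : V →ₗ[ℝ] V}
    (hS : IsCliffordFamily (Fin.snoc (α := fun _ => V →ₗ[ℝ] V) S R)) (hn : n ≠ 0)
    (hV : finrank ℝ V = 2 * n) (hT : ∀ x, T (T x) = x) (hST : ∀ i x, S i (T x) = T (S i x))
    (hRT : ∀ x, R (T x) = T (R x)) (w : V) :
    ∑ i, ⟪w, S i w⟫ ^ 2 - ⟪w, T w⟫ ^ 2 = -1 * innerQuadraticForm R w ^ 2 := by
  have h := hS.sum_sq_inner_eq hn hV w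
  simp only [Fin.sum_univ_castSucc, Fin.snoc_castSucc, Fin.snoc_last] at h
  have hTw : ⟪w, T w⟫ ^ 2 = ⟪w, w⟫ ^ 2 := by
    have hcomm : ∀ (i : Fin (n + 1)) (x : V),
        (Fin.snoc (α := fun _ => V →ₗ[ℝ] V) S R i : V →ₗ[ℝ] V) (T x) =
          T ((Fin.snoc (α := fun _ => V →ₗ[ℝ] V) S R i : V →ₗ[ℝ] V) x) := fun i x => by
      refine Fin.lastCases ?_ (fun i => ?_) i
      · simpa using hRT x
      · simpa using hST i x
    rcases hS.eq_or_eq_neg_of_commute hn (by omega) hT hcomm with h | h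
    · rw [h]
    · rw [h, inner_neg_right, neg_sq]
  rw [innerQuadraticForm_apply, hTw, ← h]
  ring

theorem sum_sq_sub_sum_sq_of_snoc {S : Fin (n + 1) → V →ₗ[ℝ] V} {T : Fin n → V →ₗ[ℝ] V}
    {R : V →ₗ[ℝ] V} (hS : IsCliffordFamily S)
    (hT : IsCliffordFamily (Fin.snoc (α := fun _ => V →ₗ[ℝ] V) T R)) (hn : n ≠ 0)
    (hV : finrank ℝ V = 4 * n) (hST : ∀ i j x, S i (T j x) = T j (S i x))
    (hSR : ∀ i x, S i (R x) = R (S i x)) (w : V) :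
    ∑ i, ⟪w, S i w⟫ ^ 2 - ∑ j, ⟪w, T j w⟫ ^ 2 = 1 * innerQuadraticForm R w ^ 2 := by
  have h := hS.sum_sq_inner_eq_of_commute hT hn (fun i j x => by
    refine Fin.lastCases ?_ (fun j => ?_) j
    · simpa using hSR i x
    · simpa using hST i j x) hV w
  rw [h, innerQuadraticForm_apply, Fin.sum_univ_castSucc]
  simp

/-- The volume element of `T` alone is skew; the factor `S 0 S 1 S 2`, central among the `S i`,
corrects this without losing commutation with `S`. -/
theorem sum_sq_sub_sum_sq_three_two {S : Fin 3 → V →ₗ[ℝ] V} {T : Fin 2 → V →ₗ[ℝ] V}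
    (hS : IsCliffordFamily S) (hT : IsCliffordFamily T)
    (hST : ∀ i j x, S i (T j x) = T j (S i x)) (hV : finrank ℝ V = 8) (w : V) :
    ∑ i, ⟪w, S i w⟫ ^ 2 - ∑ j, ⟪w, T j w⟫ ^ 2 =
      1 * innerQuadraticForm (S 0 ∘ₗ S 1 ∘ₗ S 2 ∘ₗ T 0 ∘ₗ T 1) w ^ 2 := by
  have hS' : ∀ i j x, j < i → S i (S j x) = -S j (S i x) := fun i j x h => hS.anti i j h.ne' x
  refine sum_sq_sub_sum_sq_of_snoc hS (snoc_two hS hT hST) two_ne_zero hV hST (fun i x => ?_) w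
  fin_cases i <;> simp [hS', hS.sq, ← hST]

theorem sum_sq_sub_sum_sq_five_four {S : Fin 5 → V →ₗ[ℝ] V} {T : Fin 4 → V →ₗ[ℝ] V}
    (hS : IsCliffordFamily S) (hT : IsCliffordFamily T)
    (hST : ∀ i j x, S i (T j x) = T j (S i x)) (hV : finrank ℝ V = 16) (w : V) :
    ∑ i, ⟪w, S i w⟫ ^ 2 - ∑ j, ⟪w, T j w⟫ ^ 2 =
      1 * innerQuadraticForm (T 0 ∘ₗ T 1 ∘ₗ T 2 ∘ₗ T 3) w ^ 2 :=
  sum_sq_sub_sum_sq_of_snoc hS (snoc_four hT) four_ne_zero hV hST (fun i x => by simp [hST]) w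

theorem sum_sq_sub_sq_four_one {S : Fin 4 → V →ₗ[ℝ] V} {T : V →ₗ[ℝ] V}
    (hS : IsCliffordFamily S) (hT : ∀ x, T (T x) = x)
    (hST : ∀ i x, S i (T x) = T (S i x)) (hV : finrank ℝ V = 8) (w : V) :
    ∑ i, ⟪w, S i w⟫ ^ 2 - ⟪w, T w⟫ ^ 2 =
      -1 * innerQuadraticForm (S 0 ∘ₗ S 1 ∘ₗ S 2 ∘ₗ S 3) w ^ 2 :=
  sum_sq_sub_sq_of_snoc (snoc_four hS) four_ne_zero hV hT hST (fun x => by simp [hST]) w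

theorem sum_sq_sub_sq_eight_one {S : Fin 8 → V →ₗ[ℝ] V} {T : V →ₗ[ℝ] V}
    (hS : IsCliffordFamily S) (hT : ∀ x, T (T x) = x)
    (hST : ∀ i x, S i (T x) = T (S i x)) (hV : finrank ℝ V = 16) (w : V) :
    ∑ i, ⟪w, S i w⟫ ^ 2 - ⟪w, T w⟫ ^ 2 =
      -1 * innerQuadraticForm (S 0 ∘ₗ S 1 ∘ₗ S 2 ∘ₗ S 3 ∘ₗ S 4 ∘ₗ S 5 ∘ₗ S 6 ∘ₗ S 7) w ^ 2 :=
  sum_sq_sub_sq_of_snoc (snoc_eight hS) (by norm_num) hV hT hST (fun x => by simp [hST]) w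

/-- Here `S` acts reducibly, so `T` need not be `±1`. On the plane `F` it has eigenvalues `t 0, t 1
= ±1`, and the sign of `t 0 * t 1` decides both `c` and `f`. -/
theorem exists_two_one {S : Fin 2 → V →ₗ[ℝ] V} {T : V →ₗ[ℝ] V}
    (hS : IsCliffordFamily S) (hTsymm : T.IsSymmetric) (hT : ∀ x, T (T x) = x)
    (hST : ∀ i x, S i (T x) = T (S i x)) (hV : finrank ℝ V = 4) :
    ∃ (c : ℝ) (f : QuadraticForm ℝ V), c ≠ 0 ∧
      ∀ w, ∑ i, ⟪w, S i w⟫ ^ 2 - ⟪w, T w⟫ ^ 2 = c * f w ^ 2 := by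
  set F := End.eigenspace (S 0) 1 with hF
  have hrank : finrank ℝ F = 2 := by
    have := hS.two_mul_finrank_eigenspace_zero one_ne_zero (ε := 1) (by norm_num)
    rw [← hF] at this
    omega
  have hTF : ∀ x ∈ F, T x ∈ F := fun x hx => by
    rw [hF, mem_eigenspace_one] at hx ⊢
    rw [hST, hx]
  have hTr : (T.restrict hTF).IsSymmetric := hTsymm.restrict_invariant hTF
  let b := hTr.eigenvectorBasis hrank
  let t := hTr.eigenvalues hrank
  have hbT : ∀ i, T (b i) = t i • (b i : V) := fun i =>
    congrArg Subtype.val (hTr.apply_eigenvectorBasis hrank i)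
  have ht : ∀ i, t i * t i = 1 := fun i =>
    mul_self_eq_one_of_apply_eq_smul hT
      (fun h => b.orthonormal.ne_zero i (Subtype.ext h)) (hbT i)
  have hinner : ∀ x ∈ F, ∀ y ∈ F, ⟪x, y⟫ = ⟪(b 0 : V), x⟫ * ⟪(b 0 : V), y⟫ +
      ⟪(b 1 : V), x⟫ * ⟪(b 1 : V), y⟫ := fun x hx y hy => by
    have h := b.sum_inner_mul_inner ⟨x, hx⟩ ⟨y, hy⟩
    rw [Fin.sum_univ_two] at h
    simp only [Submodule.coe_inner] at h
    rw [← h, real_inner_comm x, real_inner_comm x]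
  have hTinner : ∀ x ∈ F, ⟪x, T x⟫ = t 0 * ⟪(b 0 : V), x⟫ ^ 2 + t 1 * ⟪(b 1 : V), x⟫ ^ 2 :=
    fun x hx => by
      rw [hinner x hx _ (hTF x hx), ← hTsymm, ← hTsymm, hbT, hbT]
      simp only [inner_smul_left, conj_trivial]
      ring
  let l : Fin 2 → V →ₗ[ℝ] ℝ := fun i => innerₗ V (b i)
  let k : Fin 2 → V →ₗ[ℝ] ℝ := fun i => innerₗ V (b i) ∘ₗ S 1
  -- With `z i = l i w + √-1 k i w` the right side is `|z₀² + z₁²|² - (t₀|z₀|² + t₁|z₁|²)²`. For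
  -- `t₀t₁ = 1` this is `-4 Im(z̄₀z₁)²`, for `t₀t₁ = -1` it is `4 Re(z̄₀z₁)²`.
  have key : ∀ w, ∑ i, ⟪w, S i w⟫ ^ 2 - ⟪w, T w⟫ ^ 2 =
      (l 0 w ^ 2 + l 1 w ^ 2 - k 0 w ^ 2 - k 1 w ^ 2) ^ 2 +
        4 * (l 0 w * k 0 w + l 1 w * k 1 w) ^ 2 -
        (t 0 * (l 0 w ^ 2 + k 0 w ^ 2) + t 1 * (l 1 w ^ 2 + k 1 w ^ 2)) ^ 2 := fun w => by
    obtain ⟨u, v, hu, hv, rfl⟩ := exists_add_of_involution (S 0) (hS.sq 0) w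
    have hsv : S 0 (S 1 v) = S 1 v := hS.apply_succ_eq_self 0 hv
    have hsu : S 0 (S 1 u) = -S 1 u := hS.apply_succ_eq_neg 0 hu
    have hu' : u ∈ F := mem_eigenspace_one.mpr hu
    have hv' : S 1 v ∈ F := mem_eigenspace_one.mpr hsv
    have hb0 : ∀ i, S 0 (b i) = b i := fun i => mem_eigenspace_one.mp (b i).2
    have hl : ∀ i, l i (u + v) = ⟪(b i : V), u⟫ := fun i => by
      simp [l, inner_add_right, (hS.symm 0).inner_eq_zero_of_apply_eq_neg (hb0 i) hv]
    have hk : ∀ i, k i (u + v) = ⟪(b i : V), S 1 v⟫ := fun i => by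
      simp [k, inner_add_right, (hS.symm 0).inner_eq_zero_of_apply_eq_neg (hb0 i) hsu]
    have h1 : S 0 (T u) = T u := by rw [hST, hu]
    have h2 : S 0 (T v) = -T v := by rw [hST, hv, map_neg]
    have h3 := (hS.symm 0).inner_eq_zero_of_apply_eq_neg hu h2
    have h4 := (hS.symm 0).inner_eq_zero_of_apply_eq_neg h1 hv
    rw [real_inner_comm] at h4
    have hTw : ⟪u + v, T (u + v)⟫ = ⟪u, T u⟫ + ⟪S 1 v, T (S 1 v)⟫ := by
      rw [← hST, ← hS.symm 1 (S 1 v), hS.sq]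
      simp only [map_add, inner_add_left, inner_add_right, h3, h4]
      ring
    have hvv : ⟪v, v⟫ = ⟪S 1 v, S 1 v⟫ := by rw [hS.inner_apply_apply, if_pos rfl]
    have huv : ⟪S (Fin.succ 0) u, v⟫ = ⟪u, S 1 v⟫ := hS.symm 1 u v
    rw [hS.sum_sq_inner hu hv, hTw, hvv, hTinner u hu', hTinner _ hv', hl, hl, hk, hk,
      hinner u hu' u hu', hinner _ hv' _ hv', Fin.sum_univ_one, huv, hinner u hu' _ hv']
    ring
  have hsq : (t 0 * t 1) * (t 0 * t 1) = 1 := by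
    rw [mul_mul_mul_comm, ht, ht, one_mul]
  rcases mul_self_eq_one_iff.mp hsq with h | h
  · refine ⟨-4, QuadraticMap.linMulLin (l 0) (k 1) - QuadraticMap.linMulLin (l 1) (k 0),
      by norm_num, fun w => ?_⟩
    rw [key, sub_apply, QuadraticMap.linMulLin_apply, QuadraticMap.linMulLin_apply]
    linear_combination -(l 0 w ^ 2 + k 0 w ^ 2) ^ 2 * ht 0 - (l 1 w ^ 2 + k 1 w ^ 2) ^ 2 * ht 1 -
      2 * (l 0 w ^ 2 + k 0 w ^ 2) * (l 1 w ^ 2 + k 1 w ^ 2) * h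
  · refine ⟨4, QuadraticMap.linMulLin (l 0) (l 1) + QuadraticMap.linMulLin (k 0) (k 1),
      by norm_num, fun w => ?_⟩
    rw [key, add_apply, QuadraticMap.linMulLin_apply, QuadraticMap.linMulLin_apply]
    linear_combination -(l 0 w ^ 2 + k 0 w ^ 2) ^ 2 * ht 0 - (l 1 w ^ 2 + k 1 w ^ 2) ^ 2 * ht 1 -
      2 * (l 0 w ^ 2 + k 0 w ^ 2) * (l 1 w ^ 2 + k 1 w ^ 2) * h

end IsCliffordFamily

/-- The difference of the squared quadratic forms of two commuting symmetric involutions of the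
plane is a multiple of a square. -/
theorem exists_sq_sub_sq_of_commute {V : Type*} [NormedAddCommGroup V] [InnerProductSpace ℝ V]
    [FiniteDimensional ℝ V] {S T : V →ₗ[ℝ] V} (hS : S.IsSymmetric) (hSS : ∀ x, S (S x) = x)
    (hT : T.IsSymmetric) (hTT : ∀ x, T (T x) = x) (hST : ∀ x, S (T x) = T (S x))
    (hV : finrank ℝ V = 2) :
    ∃ (c : ℝ) (f : QuadraticForm ℝ V), c ≠ 0 ∧
      ∀ w, ⟪w, S w⟫ ^ 2 - ⟪w, T w⟫ ^ 2 = c * f w ^ 2 := by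
  -- The weight 2 separates joint eigenvalues: `±1 ± 2` takes four distinct values, so an eigenbasis
  -- of `S + 2T` diagonalizes both.
  have hA : (S + (2 : ℝ) • T).IsSymmetric := hS.add (hT.smul (by simp))
  let b := hA.eigenvectorBasis hV
  let a := hA.eigenvalues hV
  have hb : ∀ i, S (b i) + (2 : ℝ) • T (b i) = a i • b i := hA.apply_eigenvectorBasis hV
  -- From `(S + 2T)² = 5 + 4ST`.
  have hST' : ∀ i, S (T (b i)) = ((a i ^ 2 - 5) / 4) • b i := fun i => by
    have h := congrArg (fun z => S z + (2 : ℝ) • T z) (hb i)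
    simp only [map_add, map_smul, hSS, hTT, hST] at h
    rw [hST]
    linear_combination (norm := module) (1 / 4 : ℝ) • h + (a i / 4) • hb i
  set μ : Fin 2 → ℝ := fun i => (a i ^ 2 - 5) / 4 with hμ
  have hμμ : ∀ i, μ i * μ i = 1 := fun i =>
    mul_self_eq_one_of_apply_eq_smul (R := S ∘ₗ T)
      (fun x => by simp only [LinearMap.comp_apply]; rw [hST (S _), hSS, hTT])
      (b.orthonormal.ne_zero i) (hST' i)
  have hTμ : ∀ i, T (b i) = μ i • S (b i) := fun i => by
    rw [← hSS (T (b i)), hST', map_smul]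
  have hne : ∀ i, 1 + 2 * μ i ≠ 0 := fun i h => by
    have := hμμ i
    nlinarith
  have hSb : ∀ i, S (b i) = (a i / (1 + 2 * μ i)) • b i := fun i => by
    have h := hb i
    have h' : (1 + 2 * μ i) • S (b i) = a i • b i := by
      rw [add_smul, one_smul, mul_smul, ← hTμ, h]
    rw [div_eq_inv_mul, mul_smul, ← h', inv_smul_smul₀ (hne i)]
  set s : Fin 2 → ℝ := fun i => a i / (1 + 2 * μ i) with hs
  have hTb : ∀ i, T (b i) = (μ i * s i) • b i := fun i => by rw [hTμ, hSb, smul_smul]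
  let l : Fin 2 → V →ₗ[ℝ] ℝ := fun i => innerₗ V (b i)
  have hform : ∀ (R : V →ₗ[ℝ] V) (r : Fin 2 → ℝ), R.IsSymmetric → (∀ i, R (b i) = r i • b i) →
      ∀ w, ⟪w, R w⟫ = r 0 * l 0 w ^ 2 + r 1 * l 1 w ^ 2 := fun R r hR hr w => by
    rw [← b.sum_inner_mul_inner, Fin.sum_univ_two, ← hR, ← hR, hr, hr]
    simp only [inner_smul_left, conj_trivial, l, innerₗ_apply_apply, real_inner_comm (b _) w]
    ring
  have key : ∀ w, ⟪w, S w⟫ ^ 2 - ⟪w, T w⟫ ^ 2 =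
      (2 * s 0 * s 1 * (1 - μ 0 * μ 1)) * (l 0 w * l 1 w) ^ 2 := fun w => by
    rw [hform S s hS hSb, hform T _ hT hTb]
    linear_combination -(s 0 * s 0 * l 0 w ^ 4) * hμμ 0 - (s 1 * s 1 * l 1 w ^ 4) * hμμ 1
  by_cases hc : 2 * s 0 * s 1 * (1 - μ 0 * μ 1) = 0
  -- The coefficient may vanish, for instance when `T = ±S`; then `f = 0` keeps `c` nonzero.
  · exact ⟨1, 0, one_ne_zero, fun w => by simp [key, hc]⟩
  · exact ⟨_, QuadraticMap.linMulLin (l 0) (l 1), hc, key⟩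

/-! ### Clifford relations and their transfer to Euclidean space. -/

theorem sumSq_single {n : ℕ} (i : Fin n) : sumSq n (Pi.single i 1) = 1 := by
  simp [sumSq, QuadraticMap.weightedSumSquares_apply, Pi.single_apply]

theorem isOrtho_sumSq_single {n : ℕ} {i j : Fin n} (h : i ≠ j) :
    (sumSq n).IsOrtho (Pi.single i 1) (Pi.single j 1) := by
  rw [QuadraticMap.isOrtho_def]
  simp only [sumSq, QuadraticMap.weightedSumSquares_apply, ← Finset.sum_add_distrib]
  refine Finset.sum_congr rfl fun k _ => ?_
  by_cases hi : k = i
  · subst hi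
    simp [h]
  · simp [Pi.single_apply, hi]

theorem cliffBasis_mul_self {p q : ℕ} (i : Fin p ⊕ Fin q) :
    cliffBasis p q i * cliffBasis p q i = 1 := by
  rcases i with i | i <;>
  simp [cliffBasis, CliffordAlgebra.ι_sq_scalar, sumSq_single, Algebra.TensorProduct.one_def]

theorem cliffBasis_inl_anticommute {p q : ℕ} {i j : Fin p} (h : i ≠ j) :
    cliffBasis p q (Sum.inl i) * cliffBasis p q (Sum.inl j) =
      -(cliffBasis p q (Sum.inl j) * cliffBasis p q (Sum.inl i)) := by
  simp only [cliffBasis, Algebra.TensorProduct.tmul_mul_tmul,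
    CliffordAlgebra.ι_mul_ι_comm_of_isOrtho (isOrtho_sumSq_single h), TensorProduct.neg_tmul]

theorem cliffBasis_inr_anticommute {p q : ℕ} {i j : Fin q} (h : i ≠ j) :
    cliffBasis p q (Sum.inr i) * cliffBasis p q (Sum.inr j) =
      -(cliffBasis p q (Sum.inr j) * cliffBasis p q (Sum.inr i)) := by
  simp only [cliffBasis, Algebra.TensorProduct.tmul_mul_tmul,
    CliffordAlgebra.ι_mul_ι_comm_of_isOrtho (isOrtho_sumSq_single h), TensorProduct.tmul_neg]

theorem cliffBasis_inl_inr_commute {p q : ℕ} (i : Fin p) (j : Fin q) :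
    cliffBasis p q (Sum.inl i) * cliffBasis p q (Sum.inr j) =
      cliffBasis p q (Sum.inr j) * cliffBasis p q (Sum.inl i) := by
  simp [cliffBasis]

section Representation

variable {p q m : ℕ} (ρ : CliffTensor p q →ₐ[ℝ] Matrix (Fin m) (Fin m) ℝ)

/-- The endomorphism of Euclidean space given by the matrix `ρ(eᵢ)`. -/
noncomputable def basisEnd (i : Fin p ⊕ Fin q) :
    EuclideanSpace ℝ (Fin m) →ₗ[ℝ] EuclideanSpace ℝ (Fin m) :=
  Matrix.toEuclideanLin (basisMatrix ρ i)

theorem basisEnd_apply (i : Fin p ⊕ Fin q) (x : EuclideanSpace ℝ (Fin m)) :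
    basisEnd ρ i x = WithLp.toLp 2 ((ρ (cliffBasis p q i)).mulVec x.ofLp) := rfl

theorem basisEnd_isSymmetric {i : Fin p ⊕ Fin q} (h : (basisMatrix ρ i).IsSymm) :
    (basisEnd ρ i).IsSymmetric := by
  refine Matrix.isSymmetric_toEuclideanLin_iff.mpr ?_
  rwa [Matrix.IsHermitian, Matrix.conjTranspose_eq_transpose_of_trivial]

theorem basisEnd_sq (i : Fin p ⊕ Fin q) (x : EuclideanSpace ℝ (Fin m)) :
    basisEnd ρ i (basisEnd ρ i x) = x := by
  simp [basisEnd_apply, Matrix.mulVec_mulVec, ← map_mul, cliffBasis_mul_self]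

theorem basisEnd_commute (i : Fin p) (j : Fin q) (x : EuclideanSpace ℝ (Fin m)) :
    basisEnd ρ (Sum.inl i) (basisEnd ρ (Sum.inr j) x) =
      basisEnd ρ (Sum.inr j) (basisEnd ρ (Sum.inl i) x) := by
  simp only [basisEnd_apply, Matrix.mulVec_mulVec, ← map_mul, cliffBasis_inl_inr_commute]

theorem isCliffordFamily_inl (hρ : ∀ i, (basisMatrix ρ i).IsSymm) :
    IsCliffordFamily fun i => basisEnd ρ (Sum.inl i) where
  symm i := basisEnd_isSymmetric ρ (hρ _)
  sq i := basisEnd_sq ρ _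
  anti i j h x := by
    simp only [basisEnd_apply, Matrix.mulVec_mulVec, ← map_mul, cliffBasis_inl_anticommute h]
    simp [Matrix.neg_mulVec]

theorem isCliffordFamily_inr (hρ : ∀ i, (basisMatrix ρ i).IsSymm) :
    IsCliffordFamily fun j => basisEnd ρ (Sum.inr j) where
  symm i := basisEnd_isSymmetric ρ (hρ _)
  sq i := basisEnd_sq ρ _
  anti i j h x := by
    simp only [basisEnd_apply, Matrix.mulVec_mulVec, ← map_mul, cliffBasis_inr_anticommute h]
    simp [Matrix.neg_mulVec]

theorem cliffQuartic_eq (w : EuclideanSpace ℝ (Fin m)) :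
    cliffQuartic ρ w.ofLp = ∑ i, ⟪w, basisEnd ρ (Sum.inl i) w⟫ ^ 2 -
      ∑ j, ⟪w, basisEnd ρ (Sum.inr j) w⟫ ^ 2 := by
  have h : ∀ i, cliffQuadMap ρ w.ofLp i = ⟪w, basisEnd ρ i w⟫ := fun i => by
    rw [EuclideanSpace.inner_eq_star_dotProduct, star_trivial, dotProduct_comm]
    rfl
  simp only [cliffQuartic, signatureForm, QuadraticMap.weightedSumSquares_apply,
    Fintype.sum_sum_type, h, Sum.elim_inl, Sum.elim_inr, smul_eq_mul, ← pow_two]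
  simp [sub_eq_add_neg]

end Representation

/-! ### The list of cases. -/

theorem theorem2 (p q m : ℕ)
    (hpqm : (p = 1 ∧ q = 0 ∧ 1 ≤ m) ∨
      (p, q, m) ∈ ({(2, 0, 2), (1, 1, 2), (3, 0, 4), (2, 1, 4), (5, 0, 8), (4, 1, 8), (3, 2, 8),
        (9, 0, 16), (8, 1, 16), (5, 4, 16)} : Set (ℕ × ℕ × ℕ)))
    (ρ : CliffTensor p q →ₐ[ℝ] Matrix (Fin m) (Fin m) ℝ)
    (hρ : ∀ i, (basisMatrix ρ i).IsSymm) :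
    ∃ (c : ℝ) (f : QuadraticForm ℝ (Fin m → ℝ)), c ≠ 0 ∧
      ∀ w : Fin m → ℝ, cliffQuartic ρ w = c * (f w) ^ 2 := by
  have hS := isCliffordFamily_inl ρ hρ
  have hT := isCliffordFamily_inr ρ hρ
  have hST := basisEnd_commute ρ
  suffices h : ∃ (c : ℝ) (f : QuadraticForm ℝ (EuclideanSpace ℝ (Fin m))), c ≠ 0 ∧
      ∀ w, ∑ i, ⟪w, basisEnd ρ (Sum.inl i) w⟫ ^ 2 -
        ∑ j, ⟪w, basisEnd ρ (Sum.inr j) w⟫ ^ 2 = c * f w ^ 2 by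
    obtain ⟨c, f, hc, h⟩ := h
    refine ⟨c, f.comp (WithLp.linearEquiv 2 ℝ (Fin m → ℝ)).symm.toLinearMap, hc, fun w => ?_⟩
    exact (cliffQuartic_eq ρ (WithLp.toLp 2 w)).trans (h _)
  have hV : finrank ℝ (EuclideanSpace ℝ (Fin m)) = m := finrank_euclideanSpace_fin
  -- Used with `n = 1, 2, 4, 8`, where `f` is the squared norm.
  have hopf : ∀ n, n ≠ 0 → p = n + 1 → q = 0 → m = 2 * n →
      ∃ (c : ℝ) (f : QuadraticForm ℝ (EuclideanSpace ℝ (Fin m))), c ≠ 0 ∧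
        ∀ w, ∑ i, ⟪w, basisEnd ρ (Sum.inl i) w⟫ ^ 2 -
          ∑ j, ⟪w, basisEnd ρ (Sum.inr j) w⟫ ^ 2 = c * f w ^ 2 := by
    rintro n hn rfl rfl rfl
    refine ⟨1, innerQuadraticForm LinearMap.id, one_ne_zero, fun w => ?_⟩
    rw [hS.sum_sq_inner_eq hn hV, innerQuadraticForm_apply]
    simp
  simp only [Set.mem_insert_iff, Set.mem_singleton_iff, Prod.mk.injEq] at hpqm
  rcases hpqm with ⟨rfl, rfl, -⟩ | ⟨rfl, rfl, rfl⟩ | ⟨rfl, rfl, rfl⟩ | ⟨rfl, rfl, rfl⟩ |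
    ⟨rfl, rfl, rfl⟩ | ⟨rfl, rfl, rfl⟩ | ⟨rfl, rfl, rfl⟩ | ⟨rfl, rfl, rfl⟩ | ⟨rfl, rfl, rfl⟩ |
    ⟨rfl, rfl, rfl⟩ | ⟨rfl, rfl, rfl⟩
  · refine ⟨1, innerQuadraticForm (basisEnd ρ (Sum.inl 0)), one_ne_zero, fun w => ?_⟩
    simp [innerQuadraticForm_apply]
  · exact hopf 1 (by norm_num) rfl rfl rfl
  · simp only [Fin.sum_univ_one]
    exact exists_sq_sub_sq_of_commute (hS.symm 0) (hS.sq 0) (hT.symm 0) (hT.sq 0) (hST 0 0) hV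
  · exact hopf 2 (by norm_num) rfl rfl rfl
  · simp only [Fin.sum_univ_one]
    exact hS.exists_two_one (hT.symm 0) (hT.sq 0) (fun i => hST i 0) hV
  · exact hopf 4 (by norm_num) rfl rfl rfl
  · simp only [Fin.sum_univ_one]
    exact ⟨-1, _, by norm_num, hS.sum_sq_sub_sq_four_one (hT.sq 0) (fun i => hST i 0) hV⟩
  · exact ⟨1, _, one_ne_zero, hS.sum_sq_sub_sum_sq_three_two hT hST hV⟩
  · exact hopf 8 (by norm_num) rfl rfl rfl
  · simp only [Fin.sum_univ_one]
    exact ⟨-1, _, by norm_num, hS.sum_sq_sub_sq_eight_one (hT.sq 0) (fun i => hST i 0) hV⟩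
  · exact ⟨1, _, one_ne_zero, hS.sum_sq_sub_sum_sq_five_four hT hST hV⟩
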